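/- Let $m\ge 1$ and $n_*>m$ be integers and let $\rho,\eta>0$. Let $(N(t))_{t\ge 0}$ be the number of customers in the Erlang A ($M/M/m+M$) model with arrival rate $\rho$, $m$ servers of rate $1$ and abandonment rate $\eta$; that is, $N$ is the birth-death process on $\{0,1,2,\dots\}$ with birth rate $\rho$ in every state and with death rate $n$ in the states $n\le m$ and $m+(n-m)\eta$ in the states $n\ge m$ (it is described by its jump chain and its independent exponential holding times). Let $\tau(n_*)=\min\{t\ge 0: N(t)=n_*\}$ and, for $0\le n\le n_*$, $\widehat Q_n(\theta)=E[e^{-\theta\tau(n_*)}\mid N(0)=n]$, $\theta\ge 0$. Then there are real numbers $q_0,\dots,q_{n_*}$, depending only on $m,n_*,\rho,\eta$, such that for every such process and every $0\le n\le n_*$ with $P[N(0)=n]>0$, conditionally on $N(0)=n$ the minimum $\tau(n_*)$ exists almost surely and $$q_n=E[\tau(n_*)\mid N(0)=n]=-\widehat Q_n'(0)$$ (right derivative at $0$), and these numbers are given by $$q_n=q_m+\sum_{j=n}^{m-1}j!\,\rho^{-j}\sum_{\ell=0}^{j}\frac{\rho^{\ell-1}}{\ell!},\qquad 0\le n\le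 m,$$ $$q_m=\frac1\rho\sum_{J=m}^{n_*-1}\left[\left(\frac{\rho}{\eta}\right)^{m-J}\frac{\Gamma\left(J-m+1+\frac m\eta\right)}{\Gamma\left(1+\frac m\eta\right)}\sum_{\ell=0}^{m}\frac{m!}{\ell!}\rho^{\ell-m}+\sum_{\ell=m+1}^{J}\left(\frac{\rho}{\eta}\right)^{\ell-J}\frac{\Gamma\left(J-m+1+\frac m\eta\right)}{\Gamma\left(\ell-m+1+\frac m\eta\right)}\right],$$ $$q_n=\frac1\rho\sum_{J=n}^{n_*-1}\sum_{\ell=m+1}^{J}\left(\frac{\rho}{\eta}\right)^{\ell-J}\frac{\Gamma\left(J-m+1+\frac m\eta\right)}{\Gamma\left(\ell-m+1+\frac m\eta\right)}+\frac1\rho\left(\frac{\rho}{\eta}\right)^{m}\frac{1}{\Gamma\left(1+\frac m\eta\right)}\left[\sum_{\ell=0}^{m}\frac{m!}{\ell!}\rho^{\ell-m}\right]\left[\sum_{J=n}^{n_*-1}\left(\frac{\eta}{\rho}\right)^{J}\Gamma\left(J-m+1+\frac m\eta\right)\right],\qquad m\le n<n_*,$$ and $q_{n_*}=0$. -/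

import Mathlib

open MeasureTheory ProbabilityTheory
open scoped NNReal ENNReal

/-- One-step probabilities `i → j` of the jump chain of a birth-death process on `ℕ` with birth
rates `b` and death rates `d` (used for rates with `b i + d i > 0` and `d 0 = 0`). -/
noncomputable def jumpProb (b d : ℕ → ℝ) (i j : ℕ) : ℝ :=
  if j = i + 1 then b i / (b i + d i)
  else if j + 1 = i then d i / (b i + d i)
  else 0

/-- `N` is a birth-death process on `ℕ` with birth rates `b` and death rates `d` (no absorbing
state: `b i + d i > 0` for all `i`), with an arbitrary initial law: `N` visits successively the
states `Y 0, Y 1, …` and stays there for the times `S 0, S 1, …`, where `Y` is a Markov chain with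
transition probabilities `jumpProb b d` and, given `Y`, the holding times `S k` are independent
and exponential with rates `b (Y k) + d (Y k)`. -/
structure IsBirthDeathProcess {Ω : Type*} [MeasurableSpace Ω] (b d : ℕ → ℝ) (P : Measure Ω)
    (N : ℝ≥0 → Ω → ℕ) : Prop where
  measurable : ∀ t, Measurable (N t)
  exists_jump_holding : ∃ (Y : ℕ → Ω → ℕ) (S : ℕ → Ω → ℝ),
    (∀ k, Measurable (Y k)) ∧ (∀ k, Measurable (S k)) ∧
    (∀ (k : ℕ) (i : ℕ → ℕ) (s : ℕ → ℝ), (∀ r, 0 ≤ s r) →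
      P.real {ω | ∀ r ≤ k, Y r ω = i r ∧ s r < S r ω} =
        P.real {ω | Y 0 ω = i 0} *
          (∏ r ∈ Finset.range k, jumpProb b d (i r) (i (r + 1))) *
          ∏ r ∈ Finset.range (k + 1), Real.exp (-((b (i r) + d (i r)) * s r))) ∧
    ∀ᵐ ω ∂P, ∀ (k : ℕ) (t : ℝ≥0),
      ∑ r ∈ Finset.range k, S r ω ≤ (t : ℝ) →
      (t : ℝ) < ∑ r ∈ Finset.range (k + 1), S r ω →
      N t ω = Y k ω

/-- Departure rate in state `n` with `m` servers of rate `1` and abandonment rate `η`: it is `n`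
for `n ≤ m` and `m + (n - m) η` for `n ≥ m`. -/
noncomputable def erlangADeathRate (m : ℕ) (η : ℝ) (n : ℕ) : ℝ :=
  if n ≤ m then (n : ℝ) else (m : ℝ) + ((n : ℝ) - (m : ℝ)) * η

/-- The number in system of the Erlang A model (`M/M/m+M`): arrival rate `ρ`, `m` servers of
rate `1`, abandonment rate `η`. -/
def IsErlangA {Ω : Type*} [MeasurableSpace Ω] (m : ℕ) (ρ η : ℝ) (P : Measure Ω)
    (N : ℝ≥0 → Ω → ℕ) : Prop :=
  IsBirthDeathProcess (fun _ => ρ) (erlangADeathRate m η) P N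

/-- First passage time to the state `k` (equal to `∞` if `k` is never visited). -/
noncomputable def firstPassageTime {Ω : Type*} (N : ℝ≥0 → Ω → ℕ) (k : ℕ) (ω : Ω) : ℝ≥0∞ :=
  sInf ((fun t : ℝ≥0 => (t : ℝ≥0∞)) '' {t : ℝ≥0 | N t ω = k})

/-! The mean time `u k` to climb from `k` to `k + 1` obeys `b k * u k = 1 + d k * u (k - 1)` for `k
≥ 1`, with `b 0 * u 0 = 1`. The mean passage time `q i` to `K` is the sum of these over `i ≤ k < K`;
it solves the first-step (Poisson) equation with `q K = 0`.

No strong Markov property is needed to identify it. Kill the jump chain on reaching `K`, and let `w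
k i` be the probability of having started in `n`, having stayed below `K` up to step `k`, and being
in `i` then. By the Poisson equation `∑ i, w k i * q i` drops at step `k` by exactly the expected
holding time spent there (`hasSum_killed_chain`). Telescoping bounds the total holding time; its
terms therefore tend to `0`, so the potential does too. This yields both almost sure passage
(`ae_exists_ge`) and the mean (`setLIntegral_tsum_holding`).

`exists_isLeast_of_path` transfers this to `N` path by path, and dominated convergence gives the
Laplace derivative. The Erlang A formulas solve the recursion for `u`: factorials arise up to `m`,
and above `m` the functional equation of Gamma. -/

/-- The joint law of the jump chain `Y` and the holding times `S` of a birth-death process. -/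
structure JumpHoldingLaw {Ω : Type*} [MeasurableSpace Ω] (b d : ℕ → ℝ) (P : Measure Ω)
    (Y : ℕ → Ω → ℕ) (S : ℕ → Ω → ℝ) : Prop where
  measurable_chain : ∀ k, Measurable (Y k)
  measurable_holding : ∀ k, Measurable (S k)
  law : ∀ (k : ℕ) (i : ℕ → ℕ) (s : ℕ → ℝ), (∀ r, 0 ≤ s r) →
      P.real {ω | ∀ r ≤ k, Y r ω = i r ∧ s r < S r ω} =
        P.real {ω | Y 0 ω = i 0} *
          (∏ r ∈ Finset.range k, jumpProb b d (i r) (i (r + 1))) *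
          ∏ r ∈ Finset.range (k + 1), Real.exp (-((b (i r) + d (i r)) * s r))

/-! ### Jump probabilities -/

theorem jumpProb_add_one (b d : ℕ → ℝ) (i : ℕ) :
    jumpProb b d i (i + 1) = b i / (b i + d i) := by
  simp [jumpProb]

theorem jumpProb_sub_one (b d : ℕ → ℝ) (i : ℕ) :
    jumpProb b d (i + 1) i = d (i + 1) / (b (i + 1) + d (i + 1)) := by
  rw [jumpProb, if_neg (by omega), if_pos rfl]

/-- A sum against the jump probabilities out of `i` over a range containing `i`, for a function
vanishing at the end of the range. -/
theorem sum_range_jumpProb_mul {b d q : ℕ → ℝ} (hd0 : d 0 = 0) {K i : ℕ} (hi : i < K)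
    (hq : q K = 0) :
    ∑ j ∈ Finset.range K, jumpProb b d i j * q j =
      (b i * q (i + 1) + d i * q (i - 1)) / (b i + d i) := by
  -- The neighbour `i + 1` may be `K`, outside the range; `q K = 0` allows it to be included.
  have h1 : ∑ j ∈ Finset.range K, jumpProb b d i j * q j =
      ∑ j ∈ Finset.range (K + 1), jumpProb b d i j * q j := by
    rw [Finset.sum_range_succ, hq, mul_zero, add_zero]
  rw [h1]
  rcases i with _ | i
  · rw [Finset.sum_eq_single_of_mem 1 (by simpa using hi)]
    · rw [show (1 : ℕ) = 0 + 1 from rfl, jumpProb_add_one, hd0]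
      ring
    · intro j _ hj
      rw [jumpProb, if_neg (by omega), if_neg (by omega), zero_mul]
  · have hsub : ({i, i + 2} : Finset ℕ) ⊆ Finset.range (K + 1) := by
      intro x
      simp only [Finset.mem_insert, Finset.mem_singleton, Finset.mem_range]
      omega
    rw [← Finset.sum_subset hsub]
    · rw [Finset.sum_pair (by omega), jumpProb_sub_one, jumpProb_add_one, Nat.add_sub_cancel]
      ring
    · intro j _ hj
      simp only [Finset.mem_insert, Finset.mem_singleton, not_or] at hj
      rw [jumpProb, if_neg (by omega), if_neg (by omega), zero_mul]

/-! ### Path law: positive holding times and nearest-neighbour jumps -/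

namespace JumpHoldingLaw

variable {Ω : Type*} [MeasurableSpace Ω] {b d : ℕ → ℝ} {P : Measure Ω}
  {Y : ℕ → Ω → ℕ} {S : ℕ → Ω → ℝ}

theorem measurableSet_path (h : JumpHoldingLaw b d P Y S) (k : ℕ) (i : ℕ → ℕ) :
    MeasurableSet {ω | ∀ r ≤ k, Y r ω = i r} := by
  have h1 : {ω | ∀ r ≤ k, Y r ω = i r} = ⋂ r ∈ Set.Iic k, Y r ⁻¹' {i r} := by
    ext; simp
  rw [h1]
  exact MeasurableSet.biInter (Set.to_countable _)
    fun r _ => h.measurable_chain r (measurableSet_singleton _)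

theorem measureReal_path (h : JumpHoldingLaw b d P Y S) (k : ℕ)
    (hpos : ∀ᵐ ω ∂P, ∀ r ≤ k, 0 < S r ω) (i : ℕ → ℕ) :
    P.real {ω | ∀ r ≤ k, Y r ω = i r} =
      P.real {ω | Y 0 ω = i 0} * ∏ r ∈ Finset.range k, jumpProb b d (i r) (i (r + 1)) := by
  -- With all thresholds `0` the event still demands `0 < S r`, so positivity is what removes the
  -- holding times from it.
  have h1 := h.law k i (fun _ => 0) (fun _ => le_rfl)
  simp only [mul_zero, neg_zero, Real.exp_zero, Finset.prod_const_one, mul_one] at h1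
  rw [← h1]
  refine measureReal_congr ?_
  filter_upwards [hpos] with ω hω
  exact propext ⟨fun H r hr => ⟨H r hr, hω r hr⟩, fun H r hr => (H r hr).1⟩

theorem measureReal_path_tail (h : JumpHoldingLaw b d P Y S)
    (hpos : ∀ᵐ ω ∂P, ∀ r, 0 < S r ω) (k : ℕ) (i : ℕ → ℕ) {s : ℝ} (hs : 0 ≤ s) :
    P.real {ω | (∀ r ≤ k, Y r ω = i r) ∧ s < S k ω} =
      P.real {ω | ∀ r ≤ k, Y r ω = i r} * Real.exp (-((b (i k) + d (i k)) * s)) := by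
  have h1 := h.law k i (fun r => if r = k then s else 0) (fun r => by split_ifs <;> simp [hs])
  rw [h.measureReal_path k (hpos.mono fun ω H r _ => H r),
    Finset.prod_eq_single_of_mem (s := Finset.range (k + 1)) k (by simp)
      (by intro r _ hr; simp [hr]), if_pos rfl] at *
  rw [← h1]
  refine measureReal_congr ?_
  filter_upwards [hpos] with ω hω
  refine propext ⟨fun H r hr => ⟨H.1 r hr, ?_⟩, fun H => ⟨fun r hr => (H r hr).1, ?_⟩⟩
  · split_ifs with hrk
    · exact hrk ▸ H.2
    · exact hω r
  · simpa using (H k le_rfl).2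

theorem measureReal_path_succ (h : JumpHoldingLaw b d P Y S)
    (hpos : ∀ᵐ ω ∂P, ∀ r, 0 < S r ω) (k : ℕ) (i : ℕ → ℕ) :
    P.real {ω | ∀ r ≤ k + 1, Y r ω = i r} =
      P.real {ω | ∀ r ≤ k, Y r ω = i r} * jumpProb b d (i k) (i (k + 1)) := by
  rw [h.measureReal_path _ (hpos.mono fun ω H r _ => H r),
    h.measureReal_path _ (hpos.mono fun ω H r _ => H r), Finset.prod_range_succ, mul_assoc]

variable [IsProbabilityMeasure P]

/-- If the holding times up to step `k` are positive, then the next jump is to a neighbour, and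
the holding time after it is positive. -/
theorem ae_step (h : JumpHoldingLaw b d P Y S) (hc : ∀ i, 0 < b i + d i) (hd0 : d 0 = 0)
    (k : ℕ) (hpos : ∀ᵐ ω ∂P, ∀ r ≤ k, 0 < S r ω) :
    ∀ᵐ ω ∂P, (Y (k + 1) ω = Y k ω + 1 ∨ Y (k + 1) ω + 1 = Y k ω) ∧ 0 < S (k + 1) ω := by
  -- There are countably many initial paths, so it suffices to exclude a null set for each one.
  have key : ∀ p : Fin (k + 1) → ℕ, ∀ᵐ ω ∂P, (∀ r : Fin (k + 1), Y r ω = p r) →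
      (Y (k + 1) ω = Y k ω + 1 ∨ Y (k + 1) ω + 1 = Y k ω) ∧ 0 < S (k + 1) ω := by
    intro p
    -- `e j` extends the path `p` by the value `j` at time `k + 1`.
    let e : ℕ → ℕ → ℕ := fun j r => if hr : r < k + 1 then p ⟨r, hr⟩ else j
    have he : ∀ j, ∀ r ≤ k, e j r = e 0 r := by
      intro j r hr
      simp only [e, dif_pos (Nat.lt_succ_of_le hr)]
    have hek : ∀ j, e j (k + 1) = j := by intro j; simp [e]
    let A : Set Ω := {ω | ∀ r ≤ k, Y r ω = e 0 r}
    let B : ℕ → Set Ω := fun j => {ω | Y (k + 1) ω = j ∧ 0 < S (k + 1) ω}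
    have hA : MeasurableSet A := h.measurableSet_path k _
    have hB : ∀ j, MeasurableSet (B j) := fun j =>
      (h.measurable_chain (k + 1) (measurableSet_singleton j)).inter
        (h.measurable_holding (k + 1) measurableSet_Ioi)
    have hAB : ∀ j, P.real (A ∩ B j) = P.real A * jumpProb b d (e 0 k) j := by
      intro j
      have h1 := h.law (k + 1) (e j) (fun _ => 0) (fun _ => le_rfl)
      simp only [mul_zero, neg_zero, Real.exp_zero, Finset.prod_const_one, mul_one] at h1
      rw [Finset.prod_range_succ, hek, he j k le_rfl, he j 0 (Nat.zero_le _), ← mul_assoc,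
        Finset.prod_congr rfl (g := fun r => jumpProb b d (e 0 r) (e 0 (r + 1)))
          (fun r hr => by
            have := Finset.mem_range.1 hr
            rw [he j r (by omega), he j (r + 1) (by omega)]),
        ← h.measureReal_path k hpos] at h1
      rw [← h1]
      refine measureReal_congr ?_
      filter_upwards [hpos] with ω hω
      refine propext ⟨fun H r hr => ?_, fun H => ⟨fun r hr => ?_, ?_, ?_⟩⟩
      · rcases hr.lt_or_eq with hr | rfl
        · exact ⟨(H.1 r (by omega)).trans (he j r (by omega)).symm, hω r (by omega)⟩
        · exact ⟨H.2.1.trans (hek j).symm, H.2.2⟩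
      · exact (H r (by omega)).1.trans (he j r hr)
      · exact (H (k + 1) le_rfl).1.trans (hek j)
      · exact (H (k + 1) le_rfl).2
    -- The neighbours carry all the mass: their jump probabilities add up to `1`, and from `0` the
    -- only neighbour is `1` because `d 0 = 0`.
    have hunion : ∃ B' : Set Ω, MeasurableSet B' ∧ P.real (A ∩ B') = P.real A ∧
        ∀ ω ∈ B', (Y (k + 1) ω = e 0 k + 1 ∨ Y (k + 1) ω + 1 = e 0 k) ∧ 0 < S (k + 1) ω := by
      have hcn := (hc (e 0 k)).ne'
      rcases hk : e 0 k with _ | a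
      · refine ⟨B 1, hB 1, ?_, ?_⟩
        · rw [hk, hd0, add_zero] at hcn
          rw [hAB, hk, jumpProb_add_one, hd0, add_zero, div_self hcn, mul_one]
        · exact fun ω hω => ⟨Or.inl hω.1, hω.2⟩
      · refine ⟨B (a + 2) ∪ B a, (hB _).union (hB _), ?_, ?_⟩
        · rw [Set.inter_union_distrib_left, measureReal_union _ (hA.inter (hB _)), hAB, hAB, hk,
            jumpProb_add_one, jumpProb_sub_one, ← mul_add, ← add_div, div_self (hk ▸ hcn), mul_one]
          rw [Set.disjoint_left]
          rintro ω ⟨_, h1, _⟩ ⟨_, h2, _⟩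
          omega
        · rintro ω (hω | hω)
          · exact ⟨Or.inl hω.1, hω.2⟩
          · exact ⟨Or.inr (by rw [hω.1]), hω.2⟩
    obtain ⟨B', hB', hAB', hB'2⟩ := hunion
    have hnull : P (A \ B') = 0 := by
      have h1 := measureReal_inter_add_sdiff (μ := P) (s := A) hB'
      have h2 : P.real (A \ B') = 0 := by linarith
      exact (measureReal_eq_zero_iff).1 h2
    have hek0 : e 0 k = p (Fin.last k) := by simp [e, Fin.last]
    filter_upwards [measure_eq_zero_iff_ae_notMem.1 hnull] with ω hω hp
    have hωA : ω ∈ A := fun r hr => by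
      simpa only [e, dif_pos (Nat.lt_succ_of_le hr)] using hp ⟨r, Nat.lt_succ_of_le hr⟩
    have hωB : ω ∈ B' := by
      by_contra H
      exact hω ⟨hωA, H⟩
    have hYk : Y k ω = e 0 k := hωA k le_rfl
    rw [hYk]
    exact hB'2 ω hωB
  filter_upwards [ae_all_iff.2 key] with ω hω
  exact hω (fun r => Y r ω) (fun _ => rfl)

theorem ae_pos_zero (h : JumpHoldingLaw b d P Y S) : ∀ᵐ ω ∂P, 0 < S 0 ω := by
  have key : ∀ n : ℕ, ∀ᵐ ω ∂P, Y 0 ω = n → 0 < S 0 ω := by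
    intro n
    have h1 := h.law 0 (fun _ => n) (fun _ => 0) (fun _ => le_rfl)
    simp only [mul_zero, neg_zero, Real.exp_zero, Finset.prod_const_one, mul_one,
      Finset.range_zero, Finset.prod_empty, Nat.le_zero, forall_eq] at h1
    have h2 := measureReal_inter_add_sdiff (μ := P) (s := {ω | Y 0 ω = n})
      (h.measurable_holding 0 measurableSet_Ioi : MeasurableSet {ω | 0 < S 0 ω})
    have h3 : P.real ({ω | Y 0 ω = n} \ {ω | 0 < S 0 ω}) = 0 := by
      have : {ω | Y 0 ω = n} ∩ {ω | 0 < S 0 ω} = {ω | Y 0 ω = n ∧ 0 < S 0 ω} := rfl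
      have h4 : P.real ({ω | Y 0 ω = n} ∩ {ω | 0 < S 0 ω}) +
          P.real ({ω | Y 0 ω = n} \ {ω | 0 < S 0 ω}) = P.real {ω | Y 0 ω = n} := h2
      rw [this, h1] at h4
      linarith
    filter_upwards [measure_eq_zero_iff_ae_notMem.1 ((measureReal_eq_zero_iff).1 h3)] with ω hω hn
    by_contra H
    exact hω ⟨hn, H⟩
  filter_upwards [ae_all_iff.2 key] with ω hω
  exact hω _ rfl

/-- The law gives positivity one step at a time: `ae_step` needs it up to `k` to know the
probability of the path so far, whence the induction. -/
theorem ae_holding_pos (h : JumpHoldingLaw b d P Y S) (hc : ∀ i, 0 < b i + d i) (hd0 : d 0 = 0) :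
    ∀ᵐ ω ∂P, ∀ r, 0 < S r ω := by
  have key : ∀ k, ∀ᵐ ω ∂P, ∀ r ≤ k, 0 < S r ω := by
    intro k
    induction k with
    | zero => filter_upwards [h.ae_pos_zero] with ω hω r hr; rwa [Nat.le_zero.1 hr]
    | succ k ih =>
      filter_upwards [ih, h.ae_step hc hd0 k ih] with ω h1 h2 r hr
      rcases hr.lt_or_eq with hr | rfl
      · exact h1 r (by omega)
      · exact h2.2
  filter_upwards [ae_all_iff.2 key] with ω hω r
  exact hω r r le_rfl

theorem ae_chain_step (h : JumpHoldingLaw b d P Y S) (hc : ∀ i, 0 < b i + d i) (hd0 : d 0 = 0) :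
    ∀ᵐ ω ∂P, ∀ k, Y (k + 1) ω = Y k ω + 1 ∨ Y (k + 1) ω + 1 = Y k ω := by
  refine ae_all_iff.2 fun k => ?_
  filter_upwards [h.ae_step hc hd0 k ((h.ae_holding_pos hc hd0).mono fun ω H r _ => H r)]
    with ω hω
  exact hω.1

end JumpHoldingLaw

/-! ### The chain killed on reaching `K` -/

/-- The event that the chain `Y` starts in `n`, is below `K` at the times `0, …, k`, and is in
`i` at time `k`. -/
def belowEvent {Ω : Type*} (Y : ℕ → Ω → ℕ) (n K k i : ℕ) : Set Ω :=
  {ω | Y 0 ω = n ∧ (∀ r ≤ k, Y r ω < K) ∧ Y k ω = i}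

/-- The finitely many paths in `belowEvent`. -/
def belowPaths (n K k i : ℕ) : Finset (Fin (k + 1) → ℕ) :=
  {p ∈ Fintype.piFinset fun _ => Finset.range K | p 0 = n ∧ p (Fin.last k) = i}

theorem belowEvent_eq_preimage {Ω : Type*} (Y : ℕ → Ω → ℕ) (n K k i : ℕ) :
    belowEvent Y n K k i =
      (fun ω (r : Fin (k + 1)) => Y r ω) ⁻¹' (belowPaths n K k i : Set (Fin (k + 1) → ℕ)) := by
  ext ω
  simp only [belowEvent, belowPaths, Set.mem_ofPred_eq, Set.mem_preimage, Finset.mem_coe,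
    Finset.mem_filter, Fintype.mem_piFinset, Finset.mem_range, Fin.val_zero, Fin.val_last]
  constructor
  · rintro ⟨h1, h2, h3⟩
    exact ⟨fun r => h2 r (by omega), h1, h3⟩
  · rintro ⟨h2, h1, h3⟩
    exact ⟨h1, fun r hr => h2 ⟨r, by omega⟩, h3⟩

namespace JumpHoldingLaw

variable {Ω : Type*} [MeasurableSpace Ω] {b d : ℕ → ℝ} {P : Measure Ω}
  {Y : ℕ → Ω → ℕ} {S : ℕ → Ω → ℝ}

theorem measurableSet_belowEvent (h : JumpHoldingLaw b d P Y S) (n K k i : ℕ) :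
    MeasurableSet (belowEvent Y n K k i) := by
  rw [belowEvent_eq_preimage]
  have hm : Measurable (fun ω (r : Fin (k + 1)) => Y r ω) :=
    measurable_pi_lambda _ (fun r => h.measurable_chain r)
  exact hm (Finset.measurableSet _)

variable [IsProbabilityMeasure P]

/-- Additivity over the paths of `belowEvent`. -/
theorem measureReal_belowEvent_inter (h : JumpHoldingLaw b d P Y S) (n K k i : ℕ) (B : Set Ω) :
    P.real (belowEvent Y n K k i ∩ B) = ∑ p ∈ belowPaths n K k i,
      P.real ({ω | ∀ r : Fin (k + 1), Y r ω = p r} ∩ B) := by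
  have hm : Measurable (fun ω (r : Fin (k + 1)) => Y r ω) :=
    measurable_pi_lambda _ (fun r => h.measurable_chain r)
  rw [← measureReal_restrict_apply (h.measurableSet_belowEvent n K k i), belowEvent_eq_preimage,
    ← sum_measureReal_preimage_singleton _ (fun p _ => hm (measurableSet_singleton p))]
  refine Finset.sum_congr rfl fun p _ => ?_
  rw [measureReal_restrict_apply (hm (measurableSet_singleton p))]
  congr 2
  ext ω
  simp [funext_iff]

/-- If `B` has the factor `c` on every path of length `k` that ends in `i`, then also on
`belowEvent`. -/
theorem measureReal_belowEvent_inter_of_path (h : JumpHoldingLaw b d P Y S) {n K k i : ℕ}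
    {B : Set Ω} {c : ℝ}
    (hc : ∀ p : ℕ → ℕ, p k = i →
      P.real ({ω | ∀ r ≤ k, Y r ω = p r} ∩ B) = P.real {ω | ∀ r ≤ k, Y r ω = p r} * c) :
    P.real (belowEvent Y n K k i ∩ B) = P.real (belowEvent Y n K k i) * c := by
  have h1 := h.measureReal_belowEvent_inter n K k i Set.univ
  rw [Set.inter_univ] at h1
  rw [h1, h.measureReal_belowEvent_inter n K k i B, Finset.sum_mul]
  refine Finset.sum_congr rfl fun p hp => ?_
  have hlast : p (Fin.last k) = i := (Finset.mem_filter.1 hp).2.2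
  have h2 := hc (fun r => if hr : r < k + 1 then p ⟨r, hr⟩ else 0) (by simpa [Fin.last] using hlast)
  have h3 : {ω | ∀ r ≤ k, Y r ω = if hr : r < k + 1 then p ⟨r, hr⟩ else 0} =
      {ω | ∀ r : Fin (k + 1), Y r ω = p r} := by
    ext ω
    constructor
    · intro H r
      simpa [r.2] using H r (by omega)
    · intro H r hr
      simpa [Nat.lt_succ_of_le hr] using H ⟨r, by omega⟩
  rw [h3] at h2
  rw [h2, Set.inter_univ]

theorem measureReal_belowEvent_tail (h : JumpHoldingLaw b d P Y S)
    (hpos : ∀ᵐ ω ∂P, ∀ r, 0 < S r ω) (n K k i : ℕ) {s : ℝ} (hs : 0 ≤ s) :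
    P.real (belowEvent Y n K k i ∩ {ω | s < S k ω}) =
      P.real (belowEvent Y n K k i) * Real.exp (-((b i + d i) * s)) := by
  refine h.measureReal_belowEvent_inter_of_path ?_
  rintro p rfl
  exact h.measureReal_path_tail hpos k p hs

/-- The Markov property of the chain, with the past entering only through `belowEvent`. -/
theorem measureReal_belowEvent_step (h : JumpHoldingLaw b d P Y S)
    (hpos : ∀ᵐ ω ∂P, ∀ r, 0 < S r ω) (n K k i j : ℕ) :
    P.real (belowEvent Y n K k i ∩ {ω | Y (k + 1) ω = j}) =
      P.real (belowEvent Y n K k i) * jumpProb b d i j := by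
  refine h.measureReal_belowEvent_inter_of_path ?_
  rintro p rfl
  have h1 := h.measureReal_path_succ hpos k (fun r => if r ≤ k then p r else j)
  have h2 : {ω | ∀ r ≤ k, Y r ω = if r ≤ k then p r else j} = {ω | ∀ r ≤ k, Y r ω = p r} := by
    ext ω
    exact forall₂_congr fun r hr => by rw [if_pos hr]
  rw [h2] at h1
  simp only [le_refl, if_true, Nat.not_succ_le_self, if_false] at h1
  rw [← h1]
  congr 1
  ext ω
  constructor
  · rintro ⟨H1, H2⟩ r hr
    split_ifs with hrk
    · exact H1 r hrk
    · obtain rfl : r = k + 1 := by omega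
      exact H2
  · intro H
    refine ⟨fun r hr => ?_, ?_⟩
    · simpa [hr] using H r (by omega)
    · simpa using H (k + 1) le_rfl

/-- The forward equation of the killed chain, obtained by splitting on the state at step `k`. -/
theorem measureReal_belowEvent_succ (h : JumpHoldingLaw b d P Y S)
    (hpos : ∀ᵐ ω ∂P, ∀ r, 0 < S r ω) (n K k : ℕ) {j : ℕ} (hj : j < K) :
    P.real (belowEvent Y n K (k + 1) j) =
      ∑ i ∈ Finset.range K, P.real (belowEvent Y n K k i) * jumpProb b d i j := by
  simp_rw [← h.measureReal_belowEvent_step hpos]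
  rw [← measureReal_biUnion_finset]
  · congr 1
    ext ω
    simp only [belowEvent, Set.mem_ofPred_eq, Set.mem_iUnion, Set.mem_inter_iff, Finset.mem_range,
      exists_prop]
    constructor
    · rintro ⟨h1, h2, h3⟩
      exact ⟨Y k ω, h2 k (by omega), ⟨h1, fun r hr => h2 r (by omega), rfl⟩, h3⟩
    · rintro ⟨i, _, ⟨h1, h2, _⟩, h4⟩
      refine ⟨h1, fun r hr => ?_, h4⟩
      rcases hr.lt_or_eq with hr | rfl
      · exact h2 r (by omega)
      · omega
  · intro i _ i' _ hii
    refine Set.disjoint_left.2 ?_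
    rintro ω ⟨⟨_, _, h1⟩, _⟩ ⟨⟨_, _, h2⟩, _⟩
    exact hii (h1.symm.trans h2)
  · exact fun i _ => (h.measurableSet_belowEvent n K k i).inter
      (h.measurable_chain (k + 1) (measurableSet_singleton j))

end JumpHoldingLaw

/-! ### Mean passage times and the Poisson equation -/

/-- The mean time that the birth-death process with birth rates `b` and death rates `d` takes to
go from `k` to `k + 1`. -/
noncomputable def meanUpTime (b d : ℕ → ℝ) : ℕ → ℝ
  | 0 => 1 / b 0
  | k + 1 => (1 + d (k + 1) * meanUpTime b d k) / b (k + 1)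

/-- The mean first passage time from `n` to `K ≥ n`. -/
noncomputable def meanPassageTime (b d : ℕ → ℝ) (K n : ℕ) : ℝ :=
  ∑ J ∈ Finset.Ico n K, meanUpTime b d J

theorem meanUpTime_pos {b d : ℕ → ℝ} (hb : ∀ i, 0 < b i) (hd : ∀ i, 0 ≤ d i) (k : ℕ) :
    0 < meanUpTime b d k := by
  induction k with
  | zero => have := hb 0; rw [meanUpTime]; positivity
  | succ k ih =>
    have := hb (k + 1)
    have := hd (k + 1)
    rw [meanUpTime]
    positivity

theorem meanPassageTime_nonneg {b d : ℕ → ℝ} (hb : ∀ i, 0 < b i) (hd : ∀ i, 0 ≤ d i) (K n : ℕ) :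
    0 ≤ meanPassageTime b d K n :=
  Finset.sum_nonneg fun k _ => (meanUpTime_pos hb hd k).le

theorem meanPassageTime_self (b d : ℕ → ℝ) (K : ℕ) : meanPassageTime b d K K = 0 := by
  simp [meanPassageTime]

theorem meanPassageTime_eq_add (b d : ℕ → ℝ) {K n : ℕ} (hn : n < K) :
    meanPassageTime b d K n = meanUpTime b d n + meanPassageTime b d K (n + 1) :=
  Finset.sum_eq_sum_Ico_succ_bot hn _

/-- First step analysis: the Poisson equation for the mean first passage time. -/
theorem meanPassageTime_poisson {b d : ℕ → ℝ} (hb : ∀ i, 0 < b i) (hd : ∀ i, 0 ≤ d i)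
    (hd0 : d 0 = 0) {K i : ℕ} (hi : i < K) :
    (b i * meanPassageTime b d K (i + 1) + d i * meanPassageTime b d K (i - 1)) / (b i + d i) =
      meanPassageTime b d K i - 1 / (b i + d i) := by
  have hbi := hb i
  have hdi := hd i
  have hne : b i + d i ≠ 0 := by positivity
  rw [eq_sub_iff_add_eq, ← add_div, div_eq_iff hne, meanPassageTime_eq_add b d hi]
  -- At `i = 0` the truncated `i - 1` is `0`, which is harmless because its coefficient `d 0`
  -- vanishes.
  rcases i with _ | i
  · rw [hd0, meanUpTime]
    field_simp
    ring
  · rw [Nat.add_sub_cancel, meanPassageTime_eq_add b d (show i < K by omega),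
      meanPassageTime_eq_add b d hi, meanUpTime]
    field_simp
    ring

/-- If the subprobabilities `w k` on `{0, …, K - 1}` evolve by the jump chain killed in `K`, then
the time spent below `K` is the mean first passage time averaged over `w 0`. -/
theorem hasSum_killed_chain {b d : ℕ → ℝ} (hb : ∀ i, 0 < b i) (hd : ∀ i, 0 ≤ d i)
    (hd0 : d 0 = 0) {K : ℕ} {w : ℕ → ℕ → ℝ} (hw : ∀ k i, 0 ≤ w k i)
    (hstep : ∀ k, ∀ j < K, w (k + 1) j = ∑ i ∈ Finset.range K, w k i * jumpProb b d i j) :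
    HasSum (fun k => ∑ i ∈ Finset.range K, w k i / (b i + d i))
      (∑ i ∈ Finset.range K, w 0 i * meanPassageTime b d K i) := by
  have hc : ∀ i, 0 < b i + d i := fun i => add_pos_of_pos_of_nonneg (hb i) (hd i)
  set q := meanPassageTime b d K with hq
  have hq0 : ∀ i, 0 ≤ q i := meanPassageTime_nonneg hb hd K
  set f : ℕ → ℝ := fun k => ∑ i ∈ Finset.range K, w k i / (b i + d i) with hf
  set M : ℕ → ℝ := fun k => ∑ i ∈ Finset.range K, w k i * q i with hM
  have hterm : ∀ k i, 0 ≤ w k i / (b i + d i) := fun k i => div_nonneg (hw k i) (hc i).le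
  have hf0 : ∀ k, 0 ≤ f k := fun k => Finset.sum_nonneg fun i _ => hterm k i
  have hM0 : ∀ k, 0 ≤ M k := fun k => Finset.sum_nonneg fun i _ => mul_nonneg (hw k i) (hq0 i)
  have hMstep : ∀ k, M (k + 1) = M k - f k := by
    intro k
    calc M (k + 1) = ∑ j ∈ Finset.range K, ∑ i ∈ Finset.range K,
          w k i * (jumpProb b d i j * q j) := by
          refine Finset.sum_congr rfl fun j hj => ?_
          rw [hstep k j (Finset.mem_range.1 hj), Finset.sum_mul]
          exact Finset.sum_congr rfl fun i _ => mul_assoc _ _ _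
      _ = ∑ i ∈ Finset.range K, w k i * (q i - 1 / (b i + d i)) := by
          rw [Finset.sum_comm]
          refine Finset.sum_congr rfl fun i hi => ?_
          have hi := Finset.mem_range.1 hi
          rw [← Finset.mul_sum, sum_range_jumpProb_mul hd0 hi (meanPassageTime_self b d K),
            meanPassageTime_poisson hb hd hd0 hi]
      _ = M k - f k := by
          rw [hM, hf, ← Finset.sum_sub_distrib]
          exact Finset.sum_congr rfl fun i _ => by ring
  have hpart : ∀ n, ∑ k ∈ Finset.range n, f k = M 0 - M n := by
    intro n
    induction n with
    | zero => simp
    | succ n ih => rw [Finset.sum_range_succ, ih, hMstep]; ring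
  have hsum : Summable f := summable_of_sum_range_le hf0 (c := M 0) fun n => by
    rw [hpart]; linarith [hM0 n]
  -- On the finite range, `M k` is at most the constant `∑ i, q i * (b i + d i)` times `f k`, and `f
  -- k` tends to `0` by summability.
  have hlim : Filter.Tendsto M Filter.atTop (nhds 0) := by
    have h1 := hsum.tendsto_atTop_zero.const_mul (∑ i ∈ Finset.range K, q i * (b i + d i))
    rw [mul_zero] at h1
    refine squeeze_zero hM0 (fun k => ?_) h1
    rw [hM, hf, Finset.mul_sum]
    refine Finset.sum_le_sum fun i hi => ?_
    calc w k i * q i = q i * (b i + d i) * (w k i / (b i + d i)) := by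
          have := (hc i).ne'
          field_simp
      _ ≤ _ := mul_le_mul_of_nonneg_right
          (Finset.single_le_sum (f := fun i => q i * (b i + d i))
            (fun i _ => mul_nonneg (hq0 i) (hc i).le) hi) (hterm k i)
  rw [hasSum_iff_tendsto_nat_of_nonneg hf0]
  simp_rw [hpart]
  simpa using hlim.const_sub (M 0)

/-! ### Almost sure passage and total holding time -/

namespace JumpHoldingLaw

variable {Ω : Type*} [MeasurableSpace Ω] {b d : ℕ → ℝ} {P : Measure Ω} [IsProbabilityMeasure P]
  {Y : ℕ → Ω → ℕ} {S : ℕ → Ω → ℝ}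

theorem hasSum_belowEvent (h : JumpHoldingLaw b d P Y S) (hb : ∀ i, 0 < b i) (hd : ∀ i, 0 ≤ d i)
    (hd0 : d 0 = 0) {n K : ℕ} (hn : n ≤ K) :
    HasSum (fun k => ∑ i ∈ Finset.range K, P.real (belowEvent Y n K k i) / (b i + d i))
      (P.real {ω | Y 0 ω = n} * meanPassageTime b d K n) := by
  have hc : ∀ i, 0 < b i + d i := fun i => add_pos_of_pos_of_nonneg (hb i) (hd i)
  convert hasSum_killed_chain hb hd hd0 (w := fun k i => P.real (belowEvent Y n K k i))
    (fun _ _ => measureReal_nonneg)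
    (fun k j hj => h.measureReal_belowEvent_succ (h.ae_holding_pos hc hd0) n K k hj) using 1
  have hne : ∀ i, i ≠ n → belowEvent Y n K 0 i = ∅ := by
    intro i hi
    refine Set.eq_empty_of_forall_notMem ?_
    rintro ω ⟨h1, _, h2⟩
    exact hi (h2.symm.trans h1)
  rcases hn.lt_or_eq with hn | rfl
  · rw [Finset.sum_eq_single_of_mem n (Finset.mem_range.2 hn)
      fun i _ hi => by rw [hne i hi, measureReal_empty, zero_mul]]
    congr 2
    ext ω
    constructor
    · intro H
      refine ⟨H, fun r hr => ?_, H⟩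
      rw [Nat.le_zero.1 hr, show Y 0 ω = n from H]
      exact hn
    · exact fun H => H.1
  · rw [meanPassageTime_self, mul_zero, Finset.sum_eq_zero]
    intro i hi
    rw [hne i (Finset.mem_range.1 hi).ne, measureReal_empty, zero_mul]

/-- Summability of the expected holding times forces the mass still below `K` to tend to `0`, and
this mass bounds the probability of never reaching `K`. -/
theorem ae_exists_ge (h : JumpHoldingLaw b d P Y S) (hb : ∀ i, 0 < b i) (hd : ∀ i, 0 ≤ d i)
    (hd0 : d 0 = 0) {n K : ℕ} (hn : n ≤ K) :
    ∀ᵐ ω ∂P, Y 0 ω = n → ∃ r, K ≤ Y r ω := by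
  have hc : ∀ i, 0 < b i + d i := fun i => add_pos_of_pos_of_nonneg (hb i) (hd i)
  set A : Set Ω := {ω | Y 0 ω = n ∧ ∀ r, Y r ω < K} with hA
  have hw : ∀ i ∈ Finset.range K, Filter.Tendsto (fun k => P.real (belowEvent Y n K k i))
      Filter.atTop (nhds 0) := by
    intro i hi
    have h1 := (h.hasSum_belowEvent hb hd hd0 hn).summable.tendsto_atTop_zero.mul_const (b i + d i)
    rw [zero_mul] at h1
    refine squeeze_zero (fun _ => measureReal_nonneg) (fun k => ?_) h1
    rw [← div_le_iff₀ (hc i)]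
    exact Finset.single_le_sum (f := fun i => P.real (belowEvent Y n K k i) / (b i + d i))
      (fun i _ => div_nonneg measureReal_nonneg (hc i).le) hi
  have hsum := tendsto_finsetSum _ hw
  rw [Finset.sum_const_zero] at hsum
  have hAle : P.real A ≤ 0 := by
    refine ge_of_tendsto' hsum fun k => ?_
    refine le_trans (measureReal_mono ?_ (measure_ne_top _ _)) (measureReal_biUnion_finset_le _ _)
    rintro ω ⟨h1, h2⟩
    exact Set.mem_biUnion (Finset.mem_range.2 (h2 k)) ⟨h1, fun r _ => h2 r, rfl⟩
  have hA0 : P A = 0 := (measureReal_eq_zero_iff).1 (le_antisymm hAle measureReal_nonneg)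
  filter_upwards [measure_eq_zero_iff_ae_notMem.1 hA0] with ω hω h0
  by_contra! H
  exact hω ⟨h0, H⟩

/-- Layer-cake formula applied to the exponential tail of `S k`, whose mean in state `i` is `1 / (b
i + d i)`. -/
theorem setLIntegral_belowEvent (h : JumpHoldingLaw b d P Y S) (hc : ∀ i, 0 < b i + d i)
    (hd0 : d 0 = 0) (n K k i : ℕ) :
    ∫⁻ ω in belowEvent Y n K k i, ENNReal.ofReal (S k ω) ∂P =
      ENNReal.ofReal (P.real (belowEvent Y n K k i) / (b i + d i)) := by
  have hpos := h.ae_holding_pos hc hd0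
  rw [lintegral_eq_lintegral_meas_lt _ (ae_restrict_of_ae (hpos.mono fun ω H => (H k).le))
    (h.measurable_holding k).aemeasurable]
  have h1 : ∀ s ∈ Set.Ioi (0 : ℝ), P.restrict (belowEvent Y n K k i) {ω | s < S k ω} =
      ENNReal.ofReal (P.real (belowEvent Y n K k i) * Real.exp (-(b i + d i) * s)) := by
    intro s hs
    rw [Measure.restrict_apply' (h.measurableSet_belowEvent n K k i), Set.inter_comm, neg_mul,
      ← h.measureReal_belowEvent_tail hpos n K k i (le_of_lt hs), ofReal_measureReal]
  rw [setLIntegral_congr_fun measurableSet_Ioi h1, ← ofReal_integral_eq_lintegral_ofReal,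
    integral_const_mul, integral_exp_mul_Ioi (by linarith [hc i])]
  · congr 1
    rw [mul_zero, Real.exp_zero, neg_div_neg_eq, mul_one_div]
  · exact (integrableOn_exp_mul_Ioi (by linarith [hc i]) 0).const_mul _
  · exact Filter.Eventually.of_forall fun s => by positivity

open Classical in
/-- The mean of the total holding time before the chain reaches `K`. -/
theorem setLIntegral_tsum_holding (h : JumpHoldingLaw b d P Y S) (hb : ∀ i, 0 < b i)
    (hd : ∀ i, 0 ≤ d i) (hd0 : d 0 = 0) {n K : ℕ} (hn : n ≤ K) :
    ∫⁻ ω in {ω | Y 0 ω = n}, ∑' k, (if ∀ r ≤ k, Y r ω < K then ENNReal.ofReal (S k ω) else 0) ∂P =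
      ENNReal.ofReal (P.real {ω | Y 0 ω = n} * meanPassageTime b d K n) := by
  have hc : ∀ i, 0 < b i + d i := fun i => add_pos_of_pos_of_nonneg (hb i) (hd i)
  have hbelow : ∀ k, MeasurableSet {ω | ∀ r ≤ k, Y r ω < K} := by
    intro k
    have h1 : {ω | ∀ r ≤ k, Y r ω < K} = ⋂ r ∈ Set.Iic k, Y r ⁻¹' Set.Iio K := by
      ext; simp
    rw [h1]
    exact MeasurableSet.biInter (Set.to_countable _)
      fun r _ => h.measurable_chain r measurableSet_Iio
  have h0 : MeasurableSet {ω | Y 0 ω = n} := h.measurable_chain 0 (measurableSet_singleton n)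
  rw [lintegral_tsum fun k => (Measurable.ite (hbelow k)
    (h.measurable_holding k).ennreal_ofReal measurable_const).aemeasurable,
    ← (h.hasSum_belowEvent hb hd hd0 hn).tsum_eq,
    ENNReal.ofReal_tsum_of_nonneg (fun k => Finset.sum_nonneg fun i _ =>
      div_nonneg measureReal_nonneg (hc i).le) (h.hasSum_belowEvent hb hd hd0 hn).summable]
  refine tsum_congr fun k => ?_
  rw [ENNReal.ofReal_sum_of_nonneg fun i _ => div_nonneg measureReal_nonneg (hc i).le]
  simp_rw [← h.setLIntegral_belowEvent hc hd0]
  rw [← lintegral_biUnion_finset]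
  · have h1 : (fun ω => if ∀ r ≤ k, Y r ω < K then ENNReal.ofReal (S k ω) else 0) =
        {ω | ∀ r ≤ k, Y r ω < K}.indicator fun ω => ENNReal.ofReal (S k ω) := by
      ext ω
      simp [Set.indicator]
    rw [h1, lintegral_indicator (hbelow k), Measure.restrict_restrict (hbelow k)]
    congr 2
    ext ω
    simp only [Set.mem_inter_iff, Set.mem_ofPred_eq, belowEvent, Set.mem_iUnion, Finset.mem_range,
      exists_prop]
    constructor
    · rintro ⟨h1, h2⟩
      exact ⟨Y k ω, h1 k le_rfl, h2, h1, rfl⟩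
    · rintro ⟨i, _, h2, h1, _⟩
      exact ⟨h1, h2⟩
  · intro i _ i' _ hii
    refine Set.disjoint_left.2 ?_
    rintro ω ⟨_, _, h1⟩ ⟨_, _, h2⟩
    exact hii (h1.symm.trans h2)
  · exact fun i _ => h.measurableSet_belowEvent n K k i

end JumpHoldingLaw

/-! ### From the jump chain to the process in continuous time -/

theorem isLeast_firstPassageTime {Ω : Type*} {N : ℝ≥0 → Ω → ℕ} {K : ℕ} {ω : Ω} {t : ℝ≥0}
    (ht : IsLeast {t : ℝ≥0 | N t ω = K} t) : firstPassageTime N K ω = t :=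
  (ENNReal.coe_mono.map_isLeast ht).csInf_eq

open Classical in
/-- A path that jumps between neighbours and reaches `K` from below reaches it for the first time
when the chain does. -/
theorem exists_isLeast_of_path {Ω : Type*} {N : ℝ≥0 → Ω → ℕ} {Y : ℕ → Ω → ℕ} {S : ℕ → Ω → ℝ}
    {K : ℕ} {ω : Ω} (hS : ∀ k, 0 < S k ω)
    (hY : ∀ k, Y (k + 1) ω = Y k ω + 1 ∨ Y (k + 1) ω + 1 = Y k ω)
    (hN : ∀ (k : ℕ) (t : ℝ≥0), ∑ r ∈ Finset.range k, S r ω ≤ (t : ℝ) →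
      (t : ℝ) < ∑ r ∈ Finset.range (k + 1), S r ω → N t ω = Y k ω)
    (h0 : Y 0 ω ≤ K) (hK : ∃ k, K ≤ Y k ω) :
    ∃ t : ℝ≥0, IsLeast {t : ℝ≥0 | N t ω = K} t ∧
      (t : ℝ≥0∞) = ∑' k, if ∀ r ≤ k, Y r ω < K then ENNReal.ofReal (S k ω) else 0 := by
  set T := Nat.find hK with hT
  have hTK : K ≤ Y T ω := Nat.find_spec hK
  have hlt : ∀ r < T, Y r ω < K := fun r hr => not_le.1 (Nat.find_min hK hr)
  -- Steps of size one cannot jump over `K`.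
  have hYT : Y T ω = K := by
    rcases hT0 : T with _ | a
    · exact le_antisymm h0 (hT0 ▸ hTK)
    · have h1 := hlt a (by omega)
      rw [hT0] at hTK
      have := hY a
      omega
  have hsum0 : 0 ≤ ∑ r ∈ Finset.range T, S r ω := Finset.sum_nonneg fun r _ => (hS r).le
  refine ⟨(∑ r ∈ Finset.range T, S r ω).toNNReal, ⟨?_, ?_⟩, ?_⟩
  · have hcoe := Real.coe_toNNReal _ hsum0
    refine (hN T _ hcoe.ge ?_).trans hYT
    rw [hcoe, Finset.sum_range_succ]
    exact lt_add_of_pos_right _ (hS T)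
  -- An earlier time lies in the holding interval of some step before `T`, where the state is below
  -- `K`. Only finitely many jumps are involved, so explosion need not be ruled out.
  · intro t ht
    by_contra H
    have hltT : (t : ℝ) < ∑ r ∈ Finset.range T, S r ω := Real.lt_toNNReal_iff_coe_lt.1 (not_le.1 H)
    have hex : ∃ k, (t : ℝ) < ∑ r ∈ Finset.range k, S r ω := ⟨T, hltT⟩
    have hspec := Nat.find_spec hex
    have hle : Nat.find hex ≤ T := Nat.find_min' hex hltT
    rcases hk : Nat.find hex with _ | k
    · rw [hk, Finset.sum_range_zero] at hspec
      exact absurd hspec (not_lt.2 t.2)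
    · rw [hk] at hspec hle
      have h1 : N t ω = Y k ω :=
        hN k t (not_lt.1 (Nat.find_min hex (by omega))) hspec
      have h2 := hlt k hle
      have h3 : N t ω = K := ht
      omega
  · rw [tsum_eq_sum (s := Finset.range T)]
    · refine (ENNReal.ofReal_sum_of_nonneg fun r _ => (hS r).le).trans ?_
      refine Finset.sum_congr rfl fun k hk => ?_
      rw [if_pos fun r hr => hlt r (hr.trans_lt (Finset.mem_range.1 hk))]
    · intro k hk
      rw [if_neg]
      intro H
      have := H T (by simpa using hk)
      omega

/-- The right derivative at `0` of the Laplace transform is minus the mean. -/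
theorem hasDerivWithinAt_laplace {Ω : Type*} [MeasurableSpace Ω] {μ : Measure Ω}
    [IsProbabilityMeasure μ] {f : Ω → ℝ} (hf : Integrable f μ) (hf0 : 0 ≤ᵐ[μ] f) :
    HasDerivWithinAt (fun θ : ℝ => ∫ ω, Real.exp (-(θ * f ω)) ∂μ) (-∫ ω, f ω ∂μ)
      (Set.Ici 0) 0 := by
  have hmeas : ∀ θ : ℝ, AEStronglyMeasurable (fun ω => Real.exp (-(θ * f ω))) μ := fun θ =>
    Real.continuous_exp.comp_aestronglyMeasurable (hf.aestronglyMeasurable.const_mul θ).neg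
  have hint : ∀ θ : ℝ, 0 ≤ θ → Integrable (fun ω => Real.exp (-(θ * f ω))) μ := by
    intro θ hθ
    refine Integrable.of_bound (hmeas θ) 1 ?_
    filter_upwards [hf0] with ω hω
    rw [Real.norm_eq_abs, Real.abs_exp, Real.exp_le_one_iff]
    have : 0 ≤ θ * f ω := mul_nonneg hθ hω
    linarith
  rw [hasDerivWithinAt_iff_tendsto_slope, Set.Ici_sdiff_left, ← integral_neg]
  have hev : (fun θ : ℝ => ∫ ω, θ⁻¹ * (Real.exp (-(θ * f ω)) - 1) ∂μ) =ᶠ[nhdsWithin 0 (Set.Ioi 0)]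
      slope (fun θ : ℝ => ∫ ω, Real.exp (-(θ * f ω)) ∂μ) 0 := by
    filter_upwards [self_mem_nhdsWithin] with θ hθ
    rw [slope_def_field, integral_const_mul, integral_sub (hint θ (le_of_lt hθ))
      (integrable_const _)]
    simp
    ring
  refine Filter.Tendsto.congr' hev ?_
  refine tendsto_integral_filter_of_dominated_convergence f ?_ ?_ hf ?_
  · exact Filter.Eventually.of_forall fun θ =>
      ((hmeas θ).sub aestronglyMeasurable_const).const_mul _
  -- The difference quotient is dominated by `f`, since `1 - θ f ≤ exp (-θ f) ≤ 1`.
  · filter_upwards [self_mem_nhdsWithin] with θ (hθ : 0 < θ)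
    filter_upwards [hf0] with ω hω
    have h1 : 0 ≤ θ * f ω := mul_nonneg hθ.le hω
    have h2 := Real.add_one_le_exp (-(θ * f ω))
    have h3 : Real.exp (-(θ * f ω)) ≤ 1 := Real.exp_le_one_iff.2 (by linarith)
    rw [norm_mul, norm_inv, Real.norm_of_nonneg hθ.le, Real.norm_eq_abs, abs_of_nonpos (by linarith),
      inv_mul_le_iff₀ hθ]
    linarith
  · refine Filter.Eventually.of_forall fun ω => ?_
    have h1 : HasDerivAt (fun θ : ℝ => Real.exp (-(θ * f ω))) (-f ω) 0 := by
      simpa using (((hasDerivAt_id (0 : ℝ)).mul_const (f ω)).neg).exp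
    refine (h1.tendsto_slope.mono_left
      (nhdsWithin_mono _ fun θ (hθ : 0 < θ) => hθ.ne')).congr fun θ => ?_
    rw [slope_def_field]
    simp
    ring

/-- The first passage time upwards of a birth-death process. -/
theorem IsBirthDeathProcess.firstPassageTime_spec {Ω : Type*} [MeasurableSpace Ω] {b d : ℕ → ℝ}
    {P : Measure Ω} [IsProbabilityMeasure P] {N : ℝ≥0 → Ω → ℕ} (h : IsBirthDeathProcess b d P N)
    (hb : ∀ i, 0 < b i) (hd : ∀ i, 0 ≤ d i) (hd0 : d 0 = 0) {n K : ℕ} (hn : n ≤ K)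
    (h0 : P {ω | N 0 ω = n} ≠ 0) :
    (∀ᵐ ω ∂(ProbabilityTheory.cond P {ω | N 0 ω = n}),
      ∃ t : ℝ≥0, IsLeast {t : ℝ≥0 | N t ω = K} t) ∧
    AEMeasurable (firstPassageTime N K) (ProbabilityTheory.cond P {ω | N 0 ω = n}) ∧
    (∫⁻ ω, firstPassageTime N K ω ∂(ProbabilityTheory.cond P {ω | N 0 ω = n})) =
      ENNReal.ofReal (meanPassageTime b d K n) ∧
    HasDerivWithinAt
      (fun θ : ℝ => ∫ ω, Real.exp (-(θ * (firstPassageTime N K ω).toReal))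
        ∂(ProbabilityTheory.cond P {ω | N 0 ω = n}))
      (-(meanPassageTime b d K n)) (Set.Ici 0) 0 := by
  classical
  obtain ⟨Y, S, hYm, hSm, hlaw, hpath⟩ := h.exists_jump_holding
  have hL : JumpHoldingLaw b d P Y S := ⟨hYm, hSm, hlaw⟩
  have hc : ∀ i, 0 < b i + d i := fun i => add_pos_of_pos_of_nonneg (hb i) (hd i)
  have hpos := hL.ae_holding_pos hc hd0
  -- As `S 0 > 0`, time `0` lies in the first holding interval; so conditioning on `N 0` and on `Y
  -- 0` is the same.
  have hN0 : ∀ᵐ ω ∂P, N 0 ω = Y 0 ω := by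
    filter_upwards [hpos, hpath] with ω h1 h2
    exact h2 0 0 (by simp) (by simpa using h1 0)
  have hset : ({ω | N 0 ω = n} : Set Ω) =ᵐ[P] {ω | Y 0 ω = n} := by
    filter_upwards [hN0] with ω hω
    exact propext ⟨fun H => hω.symm.trans H, fun H => hω.trans H⟩
  have hY0 : MeasurableSet {ω | Y 0 ω = n} := hYm 0 (measurableSet_singleton n)
  have hPY0 : P {ω | Y 0 ω = n} ≠ 0 := measure_congr hset ▸ h0
  have hcond : ProbabilityTheory.cond P {ω | N 0 ω = n} =
      ProbabilityTheory.cond P {ω | Y 0 ω = n} := by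
    rw [ProbabilityTheory.cond, ProbabilityTheory.cond, measure_congr hset,
      Measure.restrict_congr_set hset]
  rw [hcond]
  set μ := ProbabilityTheory.cond P {ω | Y 0 ω = n} with hμ
  have : IsProbabilityMeasure μ := cond_isProbabilityMeasure hPY0
  set g : Ω → ℝ≥0∞ := fun ω =>
    ∑' k, if ∀ r ≤ k, Y r ω < K then ENNReal.ofReal (S k ω) else 0 with hg
  have hgm : Measurable g := by
    refine Measurable.tsum fun k => Measurable.ite ?_ (hSm k).ennreal_ofReal measurable_const
    have h1 : {ω | ∀ r ≤ k, Y r ω < K} = ⋂ r ∈ Set.Iic k, Y r ⁻¹' Set.Iio K := by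
      ext; simp
    rw [h1]
    exact MeasurableSet.biInter (Set.to_countable _) fun r _ => hYm r measurableSet_Iio
  have hae : ∀ᵐ ω ∂μ, ∃ t : ℝ≥0, IsLeast {t : ℝ≥0 | N t ω = K} t ∧ (t : ℝ≥0∞) = g ω := by
    refine Measure.ae_smul_measure ?_ _
    rw [ae_restrict_iff' hY0]
    filter_upwards [hpos, hL.ae_chain_step hc hd0, hpath, hL.ae_exists_ge hb hd hd0 hn]
      with ω h1 h2 h3 h4 h5
    exact exists_isLeast_of_path h1 h2 h3 ((show Y 0 ω = n from h5).trans_le hn) (h4 h5)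
  have hτ : firstPassageTime N K =ᵐ[μ] g := by
    filter_upwards [hae] with ω ⟨t, ht, htg⟩
    rw [isLeast_firstPassageTime ht, htg]
  have hτm : AEMeasurable (firstPassageTime N K) μ := hgm.aemeasurable.congr hτ.symm
  have hmean : ∫⁻ ω, firstPassageTime N K ω ∂μ = ENNReal.ofReal (meanPassageTime b d K n) := by
    rw [lintegral_congr_ae hτ, hμ, ProbabilityTheory.cond, lintegral_smul_measure,
      hL.setLIntegral_tsum_holding hb hd hd0 hn, ENNReal.ofReal_mul measureReal_nonneg,
      ofReal_measureReal, smul_eq_mul, ← mul_assoc,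
      ENNReal.inv_mul_cancel hPY0 (measure_ne_top _ _), one_mul]
  refine ⟨hae.mono fun ω ⟨t, ht, _⟩ => ⟨t, ht⟩, hτm, hmean, ?_⟩
  have hfin : ∫⁻ ω, firstPassageTime N K ω ∂μ ≠ ∞ := hmean ▸ ENNReal.ofReal_ne_top
  have hint : ∫ ω, (firstPassageTime N K ω).toReal ∂μ = meanPassageTime b d K n := by
    rw [integral_toReal hτm (ae_lt_top' hτm hfin), hmean,
      ENNReal.toReal_ofReal (meanPassageTime_nonneg hb hd K n)]
  rw [← hint]
  exact hasDerivWithinAt_laplace (integrable_toReal_of_lintegral_ne_top hτm hfin)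
    (Filter.Eventually.of_forall fun ω => ENNReal.toReal_nonneg)

/-! ### Closed forms for Erlang A -/

theorem erlangADeathRate_nonneg {m : ℕ} {η : ℝ} (hη : 0 < η) (n : ℕ) :
    0 ≤ erlangADeathRate m η n := by
  unfold erlangADeathRate
  split_ifs with h
  · positivity
  · have : (m : ℝ) ≤ n := by exact_mod_cast (not_le.1 h).le
    have : 0 ≤ ((n : ℝ) - m) * η := mul_nonneg (by linarith) hη.le
    positivity

theorem meanUpTime_erlangA_of_le {m : ℕ} {ρ η : ℝ} (hρ : 0 < ρ) {j : ℕ} (hj : j ≤ m) :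
    meanUpTime (fun _ => ρ) (erlangADeathRate m η) j = (j.factorial : ℝ) * ρ ^ (-(j : ℤ)) *
      ∑ l ∈ Finset.range (j + 1), ρ ^ ((l : ℤ) - 1) / (l.factorial : ℝ) := by
  have hρ0 := hρ.ne'
  induction j with
  | zero => simp [meanUpTime]
  | succ j ih =>
    have hf : ((j.factorial : ℕ) : ℝ) ≠ 0 := by positivity
    rw [meanUpTime, ih (by omega), Finset.sum_range_succ _ (j + 1), erlangADeathRate, if_pos hj,
      Nat.factorial_succ]
    push_cast
    rw [add_sub_cancel_right, neg_add, zpow_add₀ hρ0, zpow_neg_one, zpow_neg, zpow_natCast]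
    field_simp
    ring

/-- Above `m` the death rate is `η` times the argument of Gamma one level below, so multiplying by
it raises that argument by one. The `1` in the recursion becomes the new summand `l = J + 1`. -/
theorem meanUpTime_erlangA_of_ge {m : ℕ} {ρ η : ℝ} (hρ : 0 < ρ) (hη : 0 < η) {J : ℕ}
    (hJ : m ≤ J) :
    meanUpTime (fun _ => ρ) (erlangADeathRate m η) J = 1 / ρ *
      ((ρ / η) ^ ((m : ℤ) - (J : ℤ)) *
            (Real.Gamma ((J : ℝ) - m + 1 + m / η) / Real.Gamma (1 + m / η)) *
            (∑ l ∈ Finset.range (m + 1),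
              (m.factorial : ℝ) / (l.factorial : ℝ) * ρ ^ ((l : ℤ) - (m : ℤ))) +
          ∑ l ∈ Finset.Icc (m + 1) J,
            (ρ / η) ^ ((l : ℤ) - (J : ℤ)) *
              (Real.Gamma ((J : ℝ) - m + 1 + m / η) /
                Real.Gamma ((l : ℝ) - m + 1 + m / η))) := by
  have hρ0 := hρ.ne'
  have hη0 := hη.ne'
  have hG : ∀ l : ℕ, m ≤ l → 0 < Real.Gamma ((l : ℝ) - m + 1 + m / η) := by
    intro l hl
    have : (m : ℝ) ≤ l := by exact_mod_cast hl
    have : 0 ≤ (m : ℝ) / η := by positivity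
    exact Real.Gamma_pos_of_pos (by linarith)
  induction J, hJ using Nat.le_induction with
  | base =>
    have h1 := (hG m le_rfl).ne'
    rw [sub_self, zero_add] at h1
    rw [meanUpTime_erlangA_of_le hρ le_rfl, sub_self, sub_self, zero_add, zpow_zero, div_self h1,
      Finset.Icc_eq_empty (by omega), Finset.sum_empty, add_zero, one_mul, one_mul,
      Finset.mul_sum, Finset.mul_sum]
    refine Finset.sum_congr rfl fun l _ => ?_
    rw [zpow_sub₀ hρ0, zpow_sub₀ hρ0, zpow_neg, zpow_one]
    field_simp
  | succ J hJ ih =>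
    have hJR : (m : ℝ) ≤ J := by exact_mod_cast hJ
    have hx : 0 < (J : ℝ) - m + 1 + m / η := by
      have : 0 ≤ (m : ℝ) / η := by positivity
      linarith
    have hGs : Real.Gamma (((J + 1 : ℕ) : ℝ) - m + 1 + m / η) =
        ((J : ℝ) - m + 1 + m / η) * Real.Gamma ((J : ℝ) - m + 1 + m / η) := by
      rw [← Real.Gamma_add_one hx.ne']
      congr 1
      push_cast
      ring
    have hz : ∀ a : ℤ, (ρ / η) ^ (a - ((J + 1 : ℕ) : ℤ)) = (ρ / η) ^ (a - (J : ℤ)) * (η / ρ) := by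
      intro a
      rw [Nat.cast_succ, ← sub_sub, zpow_sub_one₀ (by positivity), inv_div]
    have hd : erlangADeathRate m η (J + 1) = ((J : ℝ) - m + 1 + m / η) * η := by
      rw [erlangADeathRate, if_neg (by omega)]
      push_cast
      field_simp
      ring
    have hsum : ∑ l ∈ Finset.Icc (m + 1) (J + 1), (ρ / η) ^ ((l : ℤ) - ((J + 1 : ℕ) : ℤ)) *
          (Real.Gamma (((J + 1 : ℕ) : ℝ) - m + 1 + m / η) /
            Real.Gamma ((l : ℝ) - m + 1 + m / η)) =
        1 + (((J : ℝ) - m + 1 + m / η) * η / ρ) * ∑ l ∈ Finset.Icc (m + 1) J,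
            (ρ / η) ^ ((l : ℤ) - (J : ℤ)) * (Real.Gamma ((J : ℝ) - m + 1 + m / η) /
                Real.Gamma ((l : ℝ) - m + 1 + m / η)) := by
      rw [Finset.sum_Icc_succ_top (by omega), sub_self, zpow_zero,
        div_self (hG (J + 1) (by omega)).ne', one_mul, add_comm, Finset.mul_sum]
      congr 1
      refine Finset.sum_congr rfl fun l _ => ?_
      rw [hz, hGs]
      ring
    rw [meanUpTime, ih, hsum, hz, hGs, hd]
    field_simp
    ring

theorem corollary8 (m nstar : ℕ) (hm : 1 ≤ m) (hmn : m < nstar)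
    (ρ η : ℝ) (hρ : 0 < ρ) (hη : 0 < η) :
    ∃ q : ℕ → ℝ,
      -- `q n` is the mean first passage time from `n` to `nstar`, for every Erlang A process
      (∀ (Ω : Type*) [MeasurableSpace Ω] (P : Measure Ω) [IsProbabilityMeasure P]
        (N : ℝ≥0 → Ω → ℕ), IsErlangA m ρ η P N →
        ∀ n ≤ nstar, P {ω | N 0 ω = n} ≠ 0 →
          (∀ᵐ ω ∂(ProbabilityTheory.cond P {ω | N 0 ω = n}),
            ∃ t : ℝ≥0, IsLeast {t : ℝ≥0 | N t ω = nstar} t) ∧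
          AEMeasurable (firstPassageTime N nstar)
            (ProbabilityTheory.cond P {ω | N 0 ω = n}) ∧
          (∫⁻ ω, firstPassageTime N nstar ω ∂(ProbabilityTheory.cond P {ω | N 0 ω = n})) =
            ENNReal.ofReal (q n) ∧
          HasDerivWithinAt
            (fun θ : ℝ => ∫ ω, Real.exp (-(θ * (firstPassageTime N nstar ω).toReal))
              ∂(ProbabilityTheory.cond P {ω | N 0 ω = n}))
            (-(q n)) (Set.Ici 0) 0) ∧
      -- the case `0 ≤ n ≤ m`
      (∀ n ≤ m, q n = q m + ∑ j ∈ Finset.Ico n m,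
        (j.factorial : ℝ) * ρ ^ (-(j : ℤ)) *
          ∑ l ∈ Finset.range (j + 1), ρ ^ ((l : ℤ) - 1) / (l.factorial : ℝ)) ∧
      -- the value at `m`
      (q m = 1 / ρ * ∑ J ∈ Finset.Ico m nstar,
        ((ρ / η) ^ ((m : ℤ) - (J : ℤ)) *
            (Real.Gamma ((J : ℝ) - m + 1 + m / η) / Real.Gamma (1 + m / η)) *
            (∑ l ∈ Finset.range (m + 1),
              (m.factorial : ℝ) / (l.factorial : ℝ) * ρ ^ ((l : ℤ) - (m : ℤ))) +
          ∑ l ∈ Finset.Icc (m + 1) J,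
            (ρ / η) ^ ((l : ℤ) - (J : ℤ)) *
              (Real.Gamma ((J : ℝ) - m + 1 + m / η) /
                Real.Gamma ((l : ℝ) - m + 1 + m / η)))) ∧
      -- the case `m ≤ n < nstar`
      (∀ n, m ≤ n → n < nstar → q n =
        1 / ρ * (∑ J ∈ Finset.Ico n nstar, ∑ l ∈ Finset.Icc (m + 1) J,
            (ρ / η) ^ ((l : ℤ) - (J : ℤ)) *
              (Real.Gamma ((J : ℝ) - m + 1 + m / η) /
                Real.Gamma ((l : ℝ) - m + 1 + m / η))) +
        1 / ρ * (ρ / η) ^ m * (1 / Real.Gamma (1 + m / η)) *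
          (∑ l ∈ Finset.range (m + 1),
            (m.factorial : ℝ) / (l.factorial : ℝ) * ρ ^ ((l : ℤ) - (m : ℤ))) *
          (∑ J ∈ Finset.Ico n nstar,
            (η / ρ) ^ J * Real.Gamma ((J : ℝ) - m + 1 + m / η))) ∧
      q nstar = 0 := by
  set q := meanPassageTime (fun _ => ρ) (erlangADeathRate m η) nstar with hq
  -- The formula at `m` is valid from any start in `[m, nstar)`; the third formula only rearranges
  -- it.
  have hG : ∀ n, m ≤ n → n < nstar → q n =
      1 / ρ * ∑ J ∈ Finset.Ico n nstar,
        ((ρ / η) ^ ((m : ℤ) - (J : ℤ)) *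
            (Real.Gamma ((J : ℝ) - m + 1 + m / η) / Real.Gamma (1 + m / η)) *
            (∑ l ∈ Finset.range (m + 1),
              (m.factorial : ℝ) / (l.factorial : ℝ) * ρ ^ ((l : ℤ) - (m : ℤ))) +
          ∑ l ∈ Finset.Icc (m + 1) J,
            (ρ / η) ^ ((l : ℤ) - (J : ℤ)) *
              (Real.Gamma ((J : ℝ) - m + 1 + m / η) /
                Real.Gamma ((l : ℝ) - m + 1 + m / η))) := by
    intro n hn _
    rw [hq, meanPassageTime, Finset.mul_sum]
    exact Finset.sum_congr rfl fun J hJ =>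
      meanUpTime_erlangA_of_ge hρ hη (hn.trans (Finset.mem_Ico.1 hJ).1)
  refine ⟨q, ?_, ?_, hG m le_rfl hmn, ?_, meanPassageTime_self _ _ _⟩
  · intro Ω _ P _ N hN n hn h0
    exact IsBirthDeathProcess.firstPassageTime_spec hN (fun _ => hρ) (erlangADeathRate_nonneg hη)
      (by simp [erlangADeathRate]) hn h0
  · intro n hn
    rw [hq, meanPassageTime, meanPassageTime, 
      ← Finset.sum_Ico_consecutive (meanUpTime _ _) hn hmn.le, add_comm]
    refine congrArg _ (Finset.sum_congr rfl fun j hj => ?_)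
    exact meanUpTime_erlangA_of_le hρ (Finset.mem_Ico.1 hj).2.le
  · intro n hn hns
    rw [hG n hn hns, Finset.sum_add_distrib, mul_add, add_comm]
    congr 1
    -- Termwise, `(ρ / η) ^ (m - J)` splits as `(ρ / η) ^ m * (η / ρ) ^ J`.
    rw [Finset.mul_sum (Finset.Ico n nstar), Finset.mul_sum (Finset.Ico n nstar)]
    refine Finset.sum_congr rfl fun J _ => ?_
    rw [zpow_sub₀ (by positivity), zpow_natCast, zpow_natCast, div_eq_mul_inv ((ρ / η) ^ m),
      ← inv_pow, inv_div]
    ring
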